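/- For $z$ in the upper half plane put $q=e^{2\pi i z}$ and let \[ E_2=1-24\sum_{n\ge1}\sigma_1(n)q^n,\qquad E_4=1+240\sum_{n\ge1}\sigma_3(n)q^n,\qquad E_6=1-504\sum_{n\ge1}\sigma_5(n)q^n \] be the normalized Eisenstein series, where $\sigma_k(n)=\sum_{d\mid n}d^k$, and let $\Delta=(E_4^3-E_6^2)/1728$. Define \[ \varphi=\frac{(25E_4^4-49E_6^2E_4)+48E_6E_4^2E_2+(-49E_4^3+25E_6^2)E_2^2}{\Delta^2}. \] Let \[ \Theta_{01}(z)=\sum_{n\in\mathbb Z}(-1)^n e^{\pi i n^2 z},\qquad \Theta_{10}(z)=\sum_{n\in\mathbb Z}e^{\pi i (n+1/2)^2 z},\qquad \psi_I=\frac{7\Theta_{01}^{20}\Theta_{10}^{8}+7\Theta_{01}^{24}\Theta_{10}^{4}+2\Theta_{01}^{28}}{\Delta^2}, \] and let $\psi_S=\psi_I|_{-10}S$, that is, $\psi_S(z)=z^{10}\,\psi_I(-1/z)$. Then for every real $t>0$ the number $\varphi(it)-\frac{432}{\pi^2}\psi_S(it)$ is real and \[ \varphi(it)-\frac{432}{\pi^2}\,\psi_S(it)>0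 . \] -/

import Mathlib

open scoped UpperHalfPlane ModularForm

noncomputable section

namespace LeechPacking

/-- The normalized modular discriminant `Δ = (E₄³ - E₆²) / 1728 = q - 24 q² + ⋯`.
Here, as below, `E2`, `E₄`, `E₆` are Mathlib's normalized Eisenstein series of level one
(constant term `1`), with `q`-expansions `1 - 24 ∑ σ₁(n) qⁿ`, `1 + 240 ∑ σ₃(n) qⁿ` and
`1 - 504 ∑ σ₅(n) qⁿ`, where `q = exp (2 π i z)`. -/
def Delta (z : ℍ) : ℂ :=
  (ModularForm.E₄ z ^ 3 - ModularForm.E₆ z ^ 2) / 1728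

/-- The weakly holomorphic quasimodular form `φ` of weight `-8` and depth `2`. -/
def phi (z : ℍ) : ℂ :=
  ((25 * ModularForm.E₄ z ^ 4 - 49 * ModularForm.E₆ z ^ 2 * ModularForm.E₄ z)
      + 48 * ModularForm.E₆ z * ModularForm.E₄ z ^ 2 * EisensteinSeries.E2 z
      + (-49 * ModularForm.E₄ z ^ 3 + 25 * ModularForm.E₆ z ^ 2) * EisensteinSeries.E2 z ^ 2)
    / Delta z ^ 2

/-- The theta function `Θ₀₁(z) = ∑_{n ∈ ℤ} (-1)ⁿ exp (π i n² z)`. -/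
def Theta01 (z : ℍ) : ℂ :=
  ∑' n : ℤ, (-1 : ℂ) ^ n * Complex.exp (Real.pi * Complex.I * (n : ℂ) ^ 2 * (z : ℂ))

/-- The theta function `Θ₁₀(z) = ∑_{n ∈ ℤ} exp (π i (n + 1/2)² z)`. -/
def Theta10 (z : ℍ) : ℂ :=
  ∑' n : ℤ, Complex.exp (Real.pi * Complex.I * ((n : ℂ) + 1 / 2) ^ 2 * (z : ℂ))

/-- The weakly holomorphic modular form `ψ_I` of weight `-10` for `Γ(2)`. -/
def psiI (z : ℍ) : ℂ :=
  (7 * Theta01 z ^ 20 * Theta10 z ^ 8 + 7 * Theta01 z ^ 24 * Theta10 z ^ 4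
      + 2 * Theta01 z ^ 28)
    / Delta z ^ 2

/-- `ψ_S = ψ_I |₋₁₀ S` with `S = (0 -1; 1 0)`, that is, `ψ_S(z) = z ^ 10 * ψ_I(-1 / z)`. -/
def psiS : ℍ → ℂ := psiI ∣[(-10 : ℤ)] ModularGroup.S

/-- The point `i t` of the upper half plane, for real `t > 0`. -/
def imPoint (t : ℝ) (ht : 0 < t) : ℍ :=
  ⟨Complex.I * (t : ℂ), by simpa using ht⟩

end LeechPacking

end

/-! All functions involved are real on the imaginary axis, so positivity can be read off truncated
expansions in x = e^{-πt} and q = x², provided t ≥ 1; the range t ≤ 1 is reached through S.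

For t ≥ 1, the numerator of φ equals 25(E₂E₆ - E₄²)² - 49E₄(E₂E₄ - E₆)² (`phiNumerator_eq`). Its q²
terms cancel, so it is at least a constant times -x⁶. S swaps Θ₀₁⁴ and Θ₁₀⁴ up to a factor, and
(it)¹⁰ = -t¹⁰, so -ψ_S Δ² is positive of order x⁵ and wins (`phiNumerator_add_pos`).

For t = 1/s ≤ 1, the anomaly of E₂ under S turns φ into (πs)²N - 6πs·C + 36B over (πs)² s⁸ Δ(is)²,
where N is the numerator, C = ∂N/∂E₂ and B is the coefficient of E₂². The ψ term adds 432 = 36·12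
times the numerator of ψ_I, whose constant 2 cancels the -24 of B. The remaining order-q terms are
dominated by -6πs·C (`phiNumerator_inv_add_pos`, via `leadingTerms_pos`). -/

namespace LeechPacking

/-! ### Truncated expansions of the Eisenstein polynomials in q. -/

section EisensteinEstimates

variable {q S₁ S₃ S₅ : ℝ}

/-- By Ramanujan, E₂E₄ - E₆ = 3q dE₄/dq = 720(q + 18q² + ⋯); the constants 17 and 19 here and below
bracket 18. -/
lemma serreDerivE4_le (hq : 0 < q) (hq' : q ≤ 3 / 1600) (l₁ : q + 3 * q ^ 2 ≤ S₁)
    (l₃ : q + 9 * q ^ 2 ≤ S₃) (u₃ : S₃ ≤ q + 9 * q ^ 2 + 85 * q ^ 3)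
    (u₅ : S₅ ≤ q + 33 * q ^ 2 + 750 * q ^ 3) :
    (1 - 24 * S₁) * (1 + 240 * S₃) - (1 - 504 * S₅) ≤ 720 * (q + 19 * q ^ 2) := by
  have h₁ : 0 ≤ S₁ := le_trans (by positivity) l₁
  have h : (q + 3 * q ^ 2) * (q + 9 * q ^ 2) ≤ S₁ * S₃ := by gcongr
  nlinarith [mul_nonneg (pow_nonneg hq.le 2) (sub_nonneg.2 hq'), pow_pos hq 2, pow_pos hq 4]

lemma le_serreDerivE4 (hq : 0 < q) (hq' : q ≤ 3 / 1600) (l₁ : q + 3 * q ^ 2 ≤ S₁)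
    (u₁ : S₁ ≤ q + 3 * q ^ 2 + 10 * q ^ 3)
    (l₃ : q + 9 * q ^ 2 ≤ S₃) (u₃ : S₃ ≤ q + 9 * q ^ 2 + 85 * q ^ 3)
    (l₅ : q + 33 * q ^ 2 ≤ S₅) :
    720 * (q + 17 * q ^ 2) ≤ (1 - 24 * S₁) * (1 + 240 * S₃) - (1 - 504 * S₅) := by
  have h₁ : 0 ≤ S₁ := le_trans (by positivity) l₁
  have h₃ : 0 ≤ S₃ := le_trans (by positivity) l₃
  have h : S₁ * S₃ ≤ (q + 3 * q ^ 2 + 10 * q ^ 3) * (q + 9 * q ^ 2 + 85 * q ^ 3) := by gcongr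
  have hu := sub_nonneg.2 hq'
  nlinarith [mul_nonneg (pow_nonneg hq.le 2) hu, mul_nonneg (pow_nonneg hq.le 3) hu,
    mul_nonneg (pow_nonneg hq.le 4) hu, mul_nonneg (pow_nonneg hq.le 5) hu, pow_pos hq 2]

/-- By Ramanujan, E₂E₆ - E₄² = 2q dE₆/dq = -1008(q + 66q² + ⋯). -/
lemma serreDerivE6_le (hq : 0 < q) (hq' : q ≤ 3 / 1600) (l₁ : q + 3 * q ^ 2 ≤ S₁)
    (u₁ : S₁ ≤ q + 3 * q ^ 2 + 10 * q ^ 3) (l₃ : q + 9 * q ^ 2 ≤ S₃)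
    (l₅ : q + 33 * q ^ 2 ≤ S₅) (u₅ : S₅ ≤ q + 33 * q ^ 2 + 750 * q ^ 3) :
    (1 - 24 * S₁) * (1 - 504 * S₅) - (1 + 240 * S₃) ^ 2 ≤ -(1008 * (q + 65 * q ^ 2)) := by
  have h₁ : 0 ≤ S₁ := le_trans (by positivity) l₁
  have h₅ : 0 ≤ S₅ := le_trans (by positivity) l₅
  have h : S₁ * S₅ ≤ (q + 3 * q ^ 2 + 10 * q ^ 3) * (q + 33 * q ^ 2 + 750 * q ^ 3) := by gcongr
  have h' : (q + 9 * q ^ 2) ^ 2 ≤ S₃ ^ 2 := by gcongr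
  have hu := sub_nonneg.2 hq'
  nlinarith [mul_nonneg (pow_nonneg hq.le 2) hu, mul_nonneg (pow_nonneg hq.le 3) hu,
    mul_nonneg (pow_nonneg hq.le 4) hu, mul_nonneg (pow_nonneg hq.le 5) hu, pow_pos hq 2]

/-- Lower bound for the numerator of `φ`, written with the Ramanujan combinations `D₄` of `E₄`
and `D₆` of `E₆`. -/
lemma numerator_ge {D₄ D₆ : ℝ} (hq : 0 < q) (hq' : q ≤ 3 / 1600)
    (l₃ : q + 9 * q ^ 2 ≤ S₃) (u₃ : S₃ ≤ q + 9 * q ^ 2 + 85 * q ^ 3)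
    (l₄ : 720 * (q + 17 * q ^ 2) ≤ D₄)
    (u₄ : D₄ ≤ 720 * (q + 19 * q ^ 2)) (u₆ : D₆ ≤ -(1008 * (q + 65 * q ^ 2))) :
    -(5040 ^ 2 * 163 * q ^ 3) ≤ 25 * D₆ ^ 2 - 49 * (1 + 240 * S₃) * D₄ ^ 2 := by
  have h₃ : 0 ≤ S₃ := le_trans (by positivity) l₃
  have h₄ : 0 ≤ D₄ := le_trans (by positivity) l₄
  have h₆ : (1008 * (q + 65 * q ^ 2)) ^ 2 ≤ D₆ ^ 2 := by
    rw [← neg_sq D₆]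
    gcongr
    linarith
  have h : (1 + 240 * S₃) * D₄ ^ 2 ≤
      (1 + 240 * (q + 9 * q ^ 2 + 85 * q ^ 3)) * (720 * (q + 19 * q ^ 2)) ^ 2 := by gcongr
  have hu := sub_nonneg.2 hq'
  -- Since 25·1008² = 49·720² = 5040², this common factor divides out and the q² terms cancel. The
  -- true q³ coefficient is -144; 163 leaves slack.
  have key : 0 ≤ (q + 65 * q ^ 2) ^ 2 - (1 + 240 * (q + 9 * q ^ 2 + 85 * q ^ 3)) *
      (q + 19 * q ^ 2) ^ 2 + 163 * q ^ 3 := by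
    nlinarith [mul_nonneg (pow_nonneg hq.le 3) hu, mul_nonneg (pow_nonneg hq.le 4) hu,
      mul_nonneg (pow_nonneg hq.le 5) hu, mul_nonneg (pow_nonneg hq.le 6) hu, pow_pos hq 3]
  nlinarith

/-- Lower bound for minus the derivative of the numerator of `φ` with respect to `E₂`. -/
lemma neg_linearCoeff_ge {D₄ D₆ : ℝ} (hq : 0 < q) (hq' : q ≤ 3 / 1600)
    (l₃ : q + 9 * q ^ 2 ≤ S₃) (u₅ : S₅ ≤ q + 33 * q ^ 2 + 750 * q ^ 3)
    (hE₆ : 0 ≤ 1 - 504 * S₅)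
    (l₄ : 720 * (q + 17 * q ^ 2) ≤ D₄) (u₆ : D₆ ≤ -(1008 * (q + 65 * q ^ 2))) :
    10080 * q * (12 + 1284 * q + 243600 * q ^ 2) ≤
      98 * (1 + 240 * S₃) ^ 2 * D₄ - 50 * (1 - 504 * S₅) * D₆ := by
  have h₃ : 0 ≤ S₃ := le_trans (by positivity) l₃
  have hu := sub_nonneg.2 hq'
  have h : (1 + 240 * (q + 9 * q ^ 2)) ^ 2 * (720 * (q + 17 * q ^ 2)) ≤
      (1 + 240 * S₃) ^ 2 * D₄ := by gcongr
  have h' : (1 - 504 * (q + 33 * q ^ 2 + 750 * q ^ 3)) * (1008 * (q + 65 * q ^ 2)) ≤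
      (1 - 504 * S₅) * (-D₆) := by
    gcongr
    linarith
  -- With 10080 divided out, the subtracted polynomial is the exact truncation at q³, and all later
  -- coefficients are positive.
  have key : 0 ≤ 5 * ((1 - 504 * (q + 33 * q ^ 2 + 750 * q ^ 3)) * (q + 65 * q ^ 2)) +
      7 * ((1 + 240 * (q + 9 * q ^ 2)) ^ 2 * (q + 17 * q ^ 2)) -
      q * (12 + 1284 * q + 243600 * q ^ 2) := by
    ring_nf
    positivity
  linarith

/-- Lower bound for the coefficient of `E₂²` in the numerator of `φ`. -/
lemma quadraticCoeff_ge (hq : 0 < q) (hq' : q ≤ 3 / 1600)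
    (l₃ : q + 9 * q ^ 2 ≤ S₃) (u₃ : S₃ ≤ q + 9 * q ^ 2 + 85 * q ^ 3)
    (l₅ : q + 33 * q ^ 2 ≤ S₅) (u₅ : S₅ ≤ q + 33 * q ^ 2 + 750 * q ^ 3) :
    -24 - 60480 * q - 3265920 * q ^ 2 - 442000000 * q ^ 3 ≤
      -49 * (1 + 240 * S₃) ^ 3 + 25 * (1 - 504 * S₅) ^ 2 := by
  have h₃ : 0 ≤ S₃ := le_trans (by positivity) l₃
  have hu := sub_nonneg.2 hq'
  have h : (1 + 240 * S₃) ^ 3 ≤ (1 + 240 * (q + 9 * q ^ 2 + 85 * q ^ 3)) ^ 3 := by gcongr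
  -- The truncation of E₆ may be slightly negative, so squaring is not monotone; the loss is at most
  -- 2·(1/100)·504·750 q³ = 7560 q³.
  have h5 : -(1 / 100) ≤ 1 - 504 * (q + 33 * q ^ 2 + 750 * q ^ 3) := by
    nlinarith [mul_nonneg hq.le hu, mul_nonneg (pow_nonneg hq.le 2) hu]
  have h' : (1 - 504 * (q + 33 * q ^ 2 + 750 * q ^ 3)) ^ 2 - 7560 * q ^ 3 ≤
      (1 - 504 * S₅) ^ 2 := by
    nlinarith [mul_nonneg (sub_nonneg.2 u₅) (sub_nonneg.2 h5),
      sq_nonneg (q + 33 * q ^ 2 + 750 * q ^ 3 - S₅)]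
  refine le_trans ?_ (add_le_add (mul_le_mul_of_nonpos_left h (by norm_num : (-49 : ℝ) ≤ 0))
    (mul_le_mul_of_nonneg_left h' (by norm_num : (0 : ℝ) ≤ 25)))
  rw [← sub_nonneg]
  ring_nf
  linarith [mul_nonneg (pow_nonneg hq.le 3) hu, mul_nonneg (pow_nonneg hq.le 4) hu,
    mul_nonneg (pow_nonneg hq.le 5) hu, mul_nonneg (pow_nonneg hq.le 6) hu,
    mul_nonneg (pow_nonneg hq.le 7) hu, mul_nonneg (pow_nonneg hq.le 8) hu, pow_pos hq 3]

end EisensteinEstimates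

/-! ### Polynomial bounds for the theta numerators. -/

section ThetaEstimates

variable {x a b : ℝ}

/-- The x and x³ coefficients vanish; the latter needs the correction 4x² in the bound for `a`. -/
lemma thetaNumerator_ge (hx : 0 < x) (hx' : x ≤ 433 / 10000)
    (ha : 16 * x * (1 + 4 * x ^ 2) ≤ a) (hb : (1 - 2 * x) ^ 4 ≤ b) :
    24 - 6720 * x ^ 2 + 2357376 * x ^ 4 - 44040192 * x ^ 5 + 461690880 * x ^ 6
        - 3397386240 * x ^ 7 ≤
      12 * (7 * b ^ 5 * a ^ 2 + 7 * b ^ 6 * a + 2 * b ^ 7) := by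
  have ha0 : 0 ≤ a := le_trans (by positivity) ha
  have hb0 : 0 ≤ b := le_trans (by positivity) hb
  have h : 12 * (7 * ((1 - 2 * x) ^ 4) ^ 5 * (16 * x * (1 + 4 * x ^ 2)) ^ 2
      + 7 * ((1 - 2 * x) ^ 4) ^ 6 * (16 * x * (1 + 4 * x ^ 2)) + 2 * ((1 - 2 * x) ^ 4) ^ 7) ≤
      12 * (7 * b ^ 5 * a ^ 2 + 7 * b ^ 6 * a + 2 * b ^ 7) := by gcongr
  refine le_trans ?_ h
  rw [← sub_nonneg]
  have hu := sub_nonneg.2 hx'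
  ring_nf
  linarith [mul_nonneg (pow_nonneg hx.le 8) hu, mul_nonneg (pow_nonneg hx.le 10) hu,
    mul_nonneg (pow_nonneg hx.le 12) hu, mul_nonneg (pow_nonneg hx.le 14) hu,
    mul_nonneg (pow_nonneg hx.le 16) hu, mul_nonneg (pow_nonneg hx.le 18) hu,
    mul_nonneg (pow_nonneg hx.le 20) hu, mul_nonneg (pow_nonneg hx.le 22) hu,
    mul_nonneg (pow_nonneg hx.le 24) hu, mul_nonneg (pow_nonneg hx.le 25) hu,
    pow_pos hx 8, pow_pos hx 10, pow_pos hx 12, pow_pos hx 14, pow_pos hx 16,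
    pow_pos hx 18, pow_pos hx 20, pow_pos hx 22, pow_pos hx 24, pow_pos hx 28]

/-- The leading coefficient is 7·16⁵, and the x⁶ terms -16·7·16⁵ and 7·16⁶ cancel. -/
lemma thetaNumerator_S_ge (hx : 0 < x) (hx' : x ≤ 433 / 10000)
    (ha : 16 * x * (1 + 4 * x ^ 2) ≤ a) (hb : (1 - 2 * x) ^ 4 ≤ b) :
    7340032 * x ^ 5 ≤ 7 * a ^ 5 * b ^ 2 + 7 * a ^ 6 * b + 2 * a ^ 7 := by
  have ha' : 16 * x ≤ a := le_trans (by nlinarith [pow_pos hx 3]) ha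
  have ha0 : 0 ≤ a := le_trans (by positivity) ha'
  have hb0 : 0 ≤ b := le_trans (by positivity) hb
  have h : 7 * (16 * x) ^ 5 * ((1 - 2 * x) ^ 4) ^ 2 + 7 * (16 * x) ^ 6 * (1 - 2 * x) ^ 4
      + 2 * (16 * x) ^ 7 ≤ 7 * a ^ 5 * b ^ 2 + 7 * a ^ 6 * b + 2 * a ^ 7 := by gcongr
  refine le_trans ?_ h
  rw [← sub_nonneg]
  have hu := sub_nonneg.2 hx'
  ring_nf
  linarith [mul_nonneg (pow_nonneg hx.le 7) hu, mul_nonneg (pow_nonneg hx.le 9) hu,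
    mul_nonneg (pow_nonneg hx.le 11) hu, pow_pos hx 7, pow_pos hx 9, pow_pos hx 11,
    pow_pos hx 13]

end ThetaEstimates

/-- The inequality between the leading terms on `t ≤ 1`, in terms of `y = π / t` and
`q = exp (-2 y)`. -/
lemma leadingTerms_pos {y : ℝ} (hy : Real.pi ≤ y) {q : ℝ} (hq : q = Real.exp (-(2 * y))) :
    0 < 60480 * y * (12 + 1284 * q + 243600 * q ^ 2) - 2419200 - 111600000 * q
      - 5040 ^ 2 * 163 * y ^ 2 * q ^ 2 := by
  have hy0 : 3.1415 < y := lt_of_lt_of_le Real.pi_gt_d4 hy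
  have hq0 : 0 < q := hq ▸ Real.exp_pos _
  -- With 2c = k/m, comparing m-th powers reduces e^{-2c} ≤ r to a rational inequality through a
  -- decimal bound for e.
  have upper {c r : ℝ} (k m : ℕ) (hm : m ≠ 0) (hr : 0 ≤ r) (hmc : m * (2 * c) = k)
      (h : (1 : ℝ) ≤ 2.7182818283 ^ k * r ^ m) (hc : c ≤ y) : q ≤ r := by
    have h1 : q ^ m ≤ r ^ m := by
      have h2 : q ^ m ≤ (Real.exp 1 ^ k)⁻¹ := by
        rw [hq, ← Real.exp_nat_mul, ← Real.exp_nat_mul, ← Real.exp_neg, mul_one, ← hmc]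
        gcongr
        nlinarith [(Nat.cast_nonneg m : (0 : ℝ) ≤ m)]
      refine h2.trans ?_
      rw [inv_le_iff_one_le_mul₀ (by positivity)]
      refine h.trans ?_
      rw [mul_comm]
      gcongr
      exact Real.exp_one_gt_d9.le
    exact (pow_le_pow_iff_left₀ hq0.le hr hm).1 h1
  have lower {c r : ℝ} (k m : ℕ) (hm : m ≠ 0) (hr : 0 ≤ r) (hmc : m * (2 * c) = k)
      (h : 2.7182818286 ^ k * r ^ m ≤ (1 : ℝ)) (hc : y ≤ c) : r ≤ q := by
    have h1 : r ^ m ≤ q ^ m := by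
      have h2 : (Real.exp 1 ^ k)⁻¹ ≤ q ^ m := by
        rw [hq, ← Real.exp_nat_mul, ← Real.exp_nat_mul, ← Real.exp_neg, mul_one, ← hmc]
        gcongr
        nlinarith [(Nat.cast_nonneg m : (0 : ℝ) ≤ m)]
      refine le_trans ?_ h2
      rw [← one_div, le_div_iff₀ (by positivity)]
      refine le_trans ?_ h
      rw [mul_comm]
      gcongr
      exact Real.exp_one_lt_d9.le
    exact (pow_le_pow_iff_left₀ hr hq0.le hm).1 h1
  have interval {c d l u : ℝ} (hc : 0 < c) (hl : 0 < l) (hcy : c ≤ y) (hyd : y ≤ d)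
      (hlq : l ≤ q) (hqu : q ≤ u)
      (h : 0 < 60480 * c * (12 + 1284 * l + 243600 * l ^ 2) - 2419200 - 111600000 * u
      - 5040 ^ 2 * 163 * d ^ 2 * u ^ 2) :
      0 < 60480 * y * (12 + 1284 * q + 243600 * q ^ 2) - 2419200 - 111600000 * q
      - 5040 ^ 2 * 163 * y ^ 2 * q ^ 2 := by
    have h1 : 60480 * c * (12 + 1284 * l + 243600 * l ^ 2) ≤
      60480 * y * (12 + 1284 * q + 243600 * q ^ 2) := by gcongr
    have h2 : 5040 ^ 2 * 163 * y ^ 2 * q ^ 2 ≤ 5040 ^ 2 * 163 * d ^ 2 * u ^ 2 := by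
      gcongr
    linarith
  -- Near y = π the term 60480·12·y is below 2419200, so the higher q terms are needed; hence
  -- two-sided bounds for q on short intervals up to y = 4.
  have u0 : q ≤ 0.001875 :=
    upper (c := 3.14) 157 25 (by norm_num) (by norm_num) (by norm_num) (by norm_num) (by linarith)
  rcases le_total y 3.2 with h | h1
  · exact interval (c := 3.1415) (by norm_num) (l := 0.00166) (by norm_num) hy0.le h
      (lower 32 5 (by norm_num) (by norm_num) (by norm_num) (by norm_num) h) u0 (by norm_num)
  have u1 : q ≤ 0.001662 :=
    upper 32 5 (by norm_num) (by norm_num) (by norm_num) (by norm_num) h1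
  rcases le_total y 3.3 with h | h2
  · exact interval (by norm_num) (l := 0.00136) (by norm_num) h1 h
      (lower 33 5 (by norm_num) (by norm_num) (by norm_num) (by norm_num) h) u1 (by norm_num)
  have u2 : q ≤ 0.001361 :=
    upper 33 5 (by norm_num) (by norm_num) (by norm_num) (by norm_num) h2
  rcases le_total y 3.5 with h | h3
  · exact interval (by norm_num) (l := 0.00091) (by norm_num) h2 h
      (lower 7 1 (by norm_num) (by norm_num) (by norm_num) (by norm_num) h) u2 (by norm_num)
  have u3 : q ≤ 0.000912 :=
    upper 7 1 (by norm_num) (by norm_num) (by norm_num) (by norm_num) h3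
  rcases le_total y 4 with h | h4
  · exact interval (by norm_num) (l := 0.000335) (by norm_num) h3 h
      (lower 8 1 (by norm_num) (by norm_num) (by norm_num) (by norm_num) h) u3 (by norm_num)
  have u4 : q ≤ 0.000336 :=
    upper 8 1 (by norm_num) (by norm_num) (by norm_num) (by norm_num) h4
  have h5 : y ^ 2 * q ≤ (3 / 8) ^ 2 := by
    -- From y³/6 ≤ e^y, y e^{-y} ≤ 6/y² ≤ 3/8 once y ≥ 4.
    have h6 : y * Real.exp (-y) ≤ 3 / 8 := by
      rw [Real.exp_neg, ← div_eq_mul_inv, div_le_iff₀ (Real.exp_pos _)]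
      have := Real.pow_div_factorial_le_exp y (by linarith) 3
      norm_num [Nat.factorial] at this
      nlinarith [mul_self_nonneg (y - 4), mul_nonneg (by linarith : 0 ≤ y) (sub_nonneg.2 h4),
        mul_nonneg (mul_nonneg (by linarith : 0 ≤ y) (sub_nonneg.2 h4)) (by linarith : 0 ≤ y)]
    have h7 : y ^ 2 * q = (y * Real.exp (-y)) ^ 2 := by
      rw [hq, mul_pow, ← Real.exp_nat_mul]
      congr 2
      push_cast
      ring
    rw [h7]
    have : 0 ≤ y := by linarith
    gcongr
  have h8 : y ^ 2 * q ^ 2 ≤ (3 / 8) ^ 2 * 0.000336 := by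
    calc y ^ 2 * q ^ 2 = (y ^ 2 * q) * q := by ring
      _ ≤ _ := by gcongr
  have h9 : 60480 * y * 12 ≤ 60480 * y * (12 + 1284 * q + 243600 * q ^ 2) := by
    have : 0 ≤ y := by linarith
    gcongr
    nlinarith [pow_pos hq0 2]
  norm_num at h8 u4 ⊢
  linarith

end LeechPacking

/-! ### Eisenstein series on the imaginary axis: q-series and behaviour under S. -/

namespace LeechPacking

open ArithmeticFunction

/-- The real series `∑_{n ≥ 1} σ_k(n) qⁿ`. -/
noncomputable def sigmaSeries (k : ℕ) (q : ℝ) : ℝ := ∑' n : ℕ, (sigma k (n + 1) : ℝ) * q ^ (n + 1)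

lemma summable_sigmaSeries (k : ℕ) {q : ℝ} (hq : 0 ≤ q) (hq' : q < 1) :
    Summable fun n : ℕ ↦ (sigma k (n + 1) : ℝ) * q ^ (n + 1) := by
  have h : Summable fun n : ℕ ↦ (sigma k n : ℝ) * q ^ n := by
    refine Summable.of_nonneg_of_le (fun n ↦ by positivity) (fun n ↦ ?_)
      (summable_pow_mul_geometric_of_norm_lt_one (k + 1) (r := q)
        (by rwa [Real.norm_of_nonneg hq]))
    gcongr
    exact_mod_cast sigma_le_pow_succ k n
  exact (summable_nat_add_iff 1).2 h

lemma sigma_two (k : ℕ) : sigma k 2 = 1 + 2 ^ k := by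
  have : (2 : ℕ).divisors = {1, 2} := by decide
  simp [sigma_apply, this]

lemma sigmaSeries_eq (k : ℕ) {q : ℝ} (hq : 0 ≤ q) (hq' : q < 1) :
    sigmaSeries k q = q + (1 + 2 ^ k) * q ^ 2 +
      ∑' n : ℕ, (sigma k (n + 3) : ℝ) * q ^ (n + 3) := by
  rw [sigmaSeries, ← (summable_sigmaSeries k hq hq').sum_add_tsum_nat_add 2]
  simp [Finset.sum_range_succ, sigma_two, add_assoc]

lemma le_sigmaSeries (k : ℕ) {q : ℝ} (hq : 0 ≤ q) (hq' : q < 1) :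
    q + (1 + 2 ^ k) * q ^ 2 ≤ sigmaSeries k q := by
  rw [sigmaSeries_eq k hq hq']
  have : 0 ≤ ∑' n : ℕ, (sigma k (n + 3) : ℝ) * q ^ (n + 3) := tsum_nonneg fun n ↦ by positivity
  linarith

/-- The tail is geometric: σ_k(n) ≤ n^{k+1}, and n + 3 ≤ 3(4/3)ⁿ by Bernoulli. -/
lemma sigmaSeries_le (k : ℕ) {q : ℝ} (hq : 0 ≤ q) (hc : (4 / 3) ^ (k + 1) * q < 1) :
    sigmaSeries k q ≤ q + (1 + 2 ^ k) * q ^ 2 +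
      3 ^ (k + 1) / (1 - (4 / 3) ^ (k + 1) * q) * q ^ 3 := by
  have h1 : (1 : ℝ) ≤ (4 / 3) ^ (k + 1) := one_le_pow₀ (by norm_num)
  have hq' : q < 1 := lt_of_le_of_lt (by nlinarith) hc
  rw [sigmaSeries_eq k hq hq']
  have hs := summable_geometric_of_lt_one (r := (4 / 3) ^ (k + 1) * q) (by positivity) hc
  have hg := (hs.mul_left (3 ^ (k + 1))).mul_right (q ^ 3)
  have : ∑' n : ℕ, (sigma k (n + 3) : ℝ) * q ^ (n + 3) ≤
      ∑' n : ℕ, 3 ^ (k + 1) * ((4 / 3) ^ (k + 1) * q) ^ n * q ^ 3 := by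
    refine Summable.tsum_le_tsum (fun n ↦ ?_)
      ((summable_nat_add_iff 2).2 (summable_sigmaSeries k hq hq')) hg
    have hn : ((n + 3 : ℕ) : ℝ) ≤ 3 * (4 / 3) ^ n := by
      have := one_add_mul_le_pow (a := (1 / 3 : ℝ)) (by norm_num) n
      norm_num at this ⊢
      linarith
    calc (sigma k (n + 3) : ℝ) * q ^ (n + 3) ≤ ((n + 3 : ℕ) : ℝ) ^ (k + 1) * q ^ (n + 3) := by
          gcongr
          exact_mod_cast sigma_le_pow_succ k (n + 3)
      _ ≤ (3 * (4 / 3) ^ n) ^ (k + 1) * q ^ (n + 3) := by gcongr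
      _ = _ := by ring
  rw [tsum_mul_right, tsum_mul_left, tsum_geometric_of_lt_one (by positivity) hc] at this
  rw [div_eq_mul_inv]
  linarith

lemma sigmaSeries_mono (k : ℕ) {p q : ℝ} (hp : 0 ≤ p) (hpq : p ≤ q) (hq : q < 1) :
    sigmaSeries k p ≤ sigmaSeries k q := by
  refine Summable.tsum_le_tsum (fun n ↦ ?_) (summable_sigmaSeries k hp (hpq.trans_lt hq))
    (summable_sigmaSeries k (hp.trans hpq) hq)
  gcongr

lemma sigmaSeries_bounds {q : ℝ} (hq : 0 < q) (hq' : q ≤ 3 / 1600) :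
    (q + 3 * q ^ 2 ≤ sigmaSeries 1 q ∧ sigmaSeries 1 q ≤ q + 3 * q ^ 2 + 10 * q ^ 3) ∧
    (q + 9 * q ^ 2 ≤ sigmaSeries 3 q ∧ sigmaSeries 3 q ≤ q + 9 * q ^ 2 + 85 * q ^ 3) ∧
    (q + 33 * q ^ 2 ≤ sigmaSeries 5 q ∧ sigmaSeries 5 q ≤ q + 33 * q ^ 2 + 750 * q ^ 3) := by
  have l (k : ℕ) := le_sigmaSeries k hq.le (by linarith)
  have u (k : ℕ) (K : ℝ) (hc : (4 / 3) ^ (k + 1) * q < 1)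
      (hK : (3 : ℝ) ^ (k + 1) ≤ K * (1 - (4 / 3) ^ (k + 1) * q)) :
      sigmaSeries k q ≤ q + (1 + 2 ^ k) * q ^ 2 + K * q ^ 3 := by
    refine (sigmaSeries_le k hq.le hc).trans ?_
    gcongr
    rwa [div_le_iff₀ (by linarith)]
  have l1 := l 1
  have l3 := l 3
  have l5 := l 5
  have u1 := u 1 10 (by norm_num; linarith) (by norm_num; linarith)
  have u3 := u 3 85 (by norm_num; linarith) (by norm_num; linarith)
  have u5 := u 5 750 (by norm_num; linarith) (by norm_num; linarith)
  norm_num at l1 l3 l5 u1 u3 u5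
  exact ⟨⟨l1, u1⟩, ⟨l3, u3⟩, ⟨l5, u5⟩⟩

lemma ofReal_sigmaSeries (k : ℕ) (q : ℝ) :
    ((sigmaSeries k q : ℝ) : ℂ) = ∑' n : ℕ+, (sigma k n : ℂ) * (q : ℂ) ^ (n : ℕ) := by
  rw [tsum_pnat_eq_tsum_succ (f := fun n ↦ (sigma k n : ℂ) * (q : ℂ) ^ n), sigmaSeries,
    Complex.ofReal_tsum]
  simp

lemma cexp_imPoint (t : ℝ) (ht : 0 < t) :
    Complex.exp (2 * Real.pi * Complex.I * (imPoint t ht : ℂ)) =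
      (Real.exp (-(2 * (Real.pi * t))) : ℝ) := by
  rw [Complex.ofReal_exp]
  congr 1
  simp only [imPoint]
  push_cast
  linear_combination (2 * Real.pi * t : ℂ) * Complex.I_mul_I

lemma E2_imPoint (t : ℝ) (ht : 0 < t) : EisensteinSeries.E2 (imPoint t ht) =
    (1 - 24 * sigmaSeries 1 (Real.exp (-(2 * (Real.pi * t)))) : ℝ) := by
  rw [EisensteinSeries.E2_eq_tsum_cexp]
  push_cast [ofReal_sigmaSeries]
  rw [cexp_imPoint]
  push_cast
  rfl

lemma E4_imPoint (t : ℝ) (ht : 0 < t) : ModularForm.E₄ (imPoint t ht) =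
    (1 + 240 * sigmaSeries 3 (Real.exp (-(2 * (Real.pi * t)))) : ℝ) := by
  have hb : bernoulli 4 = -1 / 30 := by decide +kernel
  rw [EisensteinSeries.q_expansion_bernoulli (by norm_num) (by decide), hb]
  push_cast [ofReal_sigmaSeries]
  simp_rw [cexp_imPoint]
  push_cast
  norm_num

lemma E6_imPoint (t : ℝ) (ht : 0 < t) : ModularForm.E₆ (imPoint t ht) =
    (1 - 504 * sigmaSeries 5 (Real.exp (-(2 * (Real.pi * t)))) : ℝ) := by
  have hb : bernoulli 6 = 1 / 42 := by decide +kernel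
  rw [EisensteinSeries.q_expansion_bernoulli (by norm_num) (by decide), hb]
  push_cast [ofReal_sigmaSeries]
  simp_rw [cexp_imPoint]
  push_cast
  norm_num

lemma S_smul_imPoint (t : ℝ) (ht : 0 < t) :
    ModularGroup.S • imPoint t ht = imPoint t⁻¹ (inv_pos.2 ht) := by
  ext
  rw [UpperHalfPlane.modular_S_smul]
  simp [imPoint, mul_comm]

/-- The real value `E₂(it)`. -/
noncomputable def realE2 (t : ℝ) : ℝ := 1 - 24 * sigmaSeries 1 (Real.exp (-(2 * (Real.pi * t))))

/-- The real value `E₄(it)`. -/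
noncomputable def realE4 (t : ℝ) : ℝ := 1 + 240 * sigmaSeries 3 (Real.exp (-(2 * (Real.pi * t))))

/-- The real value `E₆(it)`. -/
noncomputable def realE6 (t : ℝ) : ℝ := 1 - 504 * sigmaSeries 5 (Real.exp (-(2 * (Real.pi * t))))

lemma realE4_inv (t : ℝ) (ht : 0 < t) : realE4 t⁻¹ = t ^ 4 * realE4 t := by
  have h : ModularForm.E₄ (ModularGroup.S • imPoint t ht) = _ :=
    SlashInvariantForm.slash_action_eqn'' ModularForm.E₄
      (MonoidHom.mem_range.2 ⟨ModularGroup.S, rfl⟩) (imPoint t ht)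
  rw [S_smul_imPoint, E4_imPoint, E4_imPoint] at h
  erw [ModularGroup.denom_S] at h
  apply Complex.ofReal_injective
  rw [realE4, h, realE4]
  simp only [imPoint]
  rw [zpow_ofNat, mul_pow, Complex.I_pow_four]
  push_cast
  ring

lemma realE6_inv (t : ℝ) (ht : 0 < t) : realE6 t⁻¹ = -t ^ 6 * realE6 t := by
  have h : ModularForm.E₆ (ModularGroup.S • imPoint t ht) = _ :=
    SlashInvariantForm.slash_action_eqn'' ModularForm.E₆
      (MonoidHom.mem_range.2 ⟨ModularGroup.S, rfl⟩) (imPoint t ht)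
  rw [S_smul_imPoint, E6_imPoint, E6_imPoint] at h
  erw [ModularGroup.denom_S] at h
  apply Complex.ofReal_injective
  rw [realE6, h, realE6]
  simp only [imPoint]
  rw [zpow_ofNat, mul_pow, show Complex.I ^ 6 = -1 by
    rw [show 6 = 2 * 3 by rfl, pow_mul, Complex.I_sq]; norm_num]
  push_cast
  ring

lemma realE2_inv (t : ℝ) (ht : 0 < t) :
    realE2 t⁻¹ = -t ^ 2 * realE2 t + 6 * t / Real.pi := by
  have h := congrFun (EisensteinSeries.E2_slash_action ModularGroup.S) (imPoint t ht)
  rw [SlashInvariantForm.slash_S_apply, ← UpperHalfPlane.modular_S_smul, S_smul_imPoint] at h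
  simp only [Pi.sub_apply, Pi.smul_apply, EisensteinSeries.D2_S, E2_imPoint, smul_eq_mul,
    riemannZeta_two] at h
  apply Complex.ofReal_injective
  have ht' : (t : ℂ) ≠ 0 := by exact_mod_cast ht.ne'
  have hp : (Real.pi : ℂ) ≠ 0 := by exact_mod_cast Real.pi_ne_zero
  simp only [imPoint] at h
  rw [realE2, realE2]
  generalize 1 - 24 * sigmaSeries 1 (Real.exp (-(2 * (Real.pi * t⁻¹)))) = u at h ⊢
  generalize 1 - 24 * sigmaSeries 1 (Real.exp (-(2 * (Real.pi * t)))) = v at h ⊢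
  push_cast at h ⊢
  rw [zpow_neg, zpow_ofNat, mul_pow, Complex.I_sq] at h
  field_simp at h ⊢
  linear_combination -h

/-- The S-transformation forces E₆(i) = 0, and E₆(it) increases with t. -/
lemma realE6_nonneg {t : ℝ} (ht : 1 ≤ t) : 0 ≤ realE6 t := by
  have h1 : realE6 1 = 0 := by
    have := realE6_inv 1 one_pos
    norm_num at this
    linarith
  have h := sigmaSeries_mono 5 (Real.exp_nonneg (-(2 * (Real.pi * t))))
    (q := Real.exp (-(2 * (Real.pi * 1)))) (by gcongr) (by simp [Real.pi_pos])
  rw [realE6] at h1 ⊢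
  linarith

end LeechPacking

/-! ### Theta functions on the imaginary axis. -/

namespace LeechPacking

lemma Theta01_eq_jacobiTheta₂ (z : ℍ) : Theta01 z = jacobiTheta₂ (1 / 2) z := by
  refine tsum_congr fun n ↦ ?_
  rw [jacobiTheta₂_term, Complex.exp_add, show 2 * (Real.pi : ℂ) * Complex.I * n * (1 / 2) =
    n * (Real.pi * Complex.I) by ring, Complex.exp_int_mul, Complex.exp_pi_mul_I]

lemma Theta10_term_eq (z : ℂ) (n : ℤ) :
    Complex.exp (Real.pi * Complex.I * ((n : ℂ) + 1 / 2) ^ 2 * z) =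
      Complex.exp (Real.pi * Complex.I * z / 4) * jacobiTheta₂_term n (z / 2) z := by
  rw [jacobiTheta₂_term, ← Complex.exp_add]
  ring_nf

lemma Theta10_eq_jacobiTheta₂ (z : ℍ) :
    Theta10 z = Complex.exp (Real.pi * Complex.I * z / 4) * jacobiTheta₂ ((z : ℂ) / 2) z := by
  simp_rw [Theta10, Theta10_term_eq, tsum_mul_left]
  rfl

/-- The real value `Θ₀₁(it)`. -/
noncomputable def realTheta01 (t : ℝ) : ℝ :=
  ∑' n : ℤ, (-1) ^ n * Real.exp (-(Real.pi * t)) ^ (n ^ 2).toNat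

/-- The real value `Θ₁₀(it)`. -/
noncomputable def realTheta10 (t : ℝ) : ℝ :=
  ∑' n : ℤ, Real.exp (-(Real.pi * t) * ((n : ℝ) + 1 / 2) ^ 2)

lemma Theta10_term_imPoint (t : ℝ) (ht : 0 < t) (n : ℤ) :
    Complex.exp (Real.pi * Complex.I * ((n : ℂ) + 1 / 2) ^ 2 * (imPoint t ht : ℂ)) =
      (Real.exp (-(Real.pi * t) * ((n : ℝ) + 1 / 2) ^ 2) : ℝ) := by
  rw [Complex.ofReal_exp]
  congr 1
  simp only [imPoint]
  push_cast
  linear_combination (Real.pi * t * ((n : ℂ) + 1 / 2) ^ 2) * Complex.I_mul_I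

lemma Theta01_term_imPoint (t : ℝ) (ht : 0 < t) (n : ℤ) :
    (-1 : ℂ) ^ n * Complex.exp (Real.pi * Complex.I * (n : ℂ) ^ 2 * (imPoint t ht : ℂ)) =
      ((-1) ^ n * Real.exp (-(Real.pi * t)) ^ (n ^ 2).toNat : ℝ) := by
  push_cast
  rw [← Complex.exp_nat_mul]
  congr 2
  simp only [imPoint]
  have : (((n ^ 2).toNat : ℤ) : ℂ) = (n : ℂ) ^ 2 := by
    rw [Int.toNat_of_nonneg (sq_nonneg n)]
    push_cast
    rfl
  rw [Int.cast_natCast] at this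
  rw [this]
  linear_combination (Real.pi * t * (n : ℂ) ^ 2) * Complex.I_mul_I

lemma Theta01_imPoint (t : ℝ) (ht : 0 < t) : Theta01 (imPoint t ht) = (realTheta01 t : ℝ) := by
  rw [Theta01, realTheta01, Complex.ofReal_tsum]
  exact tsum_congr (Theta01_term_imPoint t ht)

lemma Theta10_imPoint (t : ℝ) (ht : 0 < t) : Theta10 (imPoint t ht) = (realTheta10 t : ℝ) := by
  rw [Theta10, realTheta10, Complex.ofReal_tsum]
  exact tsum_congr (Theta10_term_imPoint t ht)

lemma summable_realTheta10 (t : ℝ) (ht : 0 < t) :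
    Summable fun n : ℤ ↦ Real.exp (-(Real.pi * t) * ((n : ℝ) + 1 / 2) ^ 2) := by
  rw [← Complex.summable_ofReal]
  simp_rw [← Theta10_term_imPoint t ht, Theta10_term_eq]
  exact ((summable_jacobiTheta₂_term_iff _ _).2 (imPoint t ht).2).mul_left _

lemma summable_realTheta01 (t : ℝ) (ht : 0 < t) :
    Summable fun n : ℤ ↦ (-1 : ℝ) ^ n * Real.exp (-(Real.pi * t)) ^ (n ^ 2).toNat := by
  rw [← Complex.summable_ofReal]
  simp_rw [← Theta01_term_imPoint t ht]
  refine ((summable_jacobiTheta₂_term_iff (1 / 2) _).2 (imPoint t ht).2).congr fun n ↦ ?_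
  rw [jacobiTheta₂_term, Complex.exp_add, show 2 * (Real.pi : ℂ) * Complex.I * n * (1 / 2) =
    n * (Real.pi * Complex.I) by ring, Complex.exp_int_mul, Complex.exp_pi_mul_I]

lemma realTheta10_pow_ge (t : ℝ) (ht : 0 < t) :
    16 * Real.exp (-(Real.pi * t)) * (1 + 4 * Real.exp (-(Real.pi * t)) ^ 2) ≤
      realTheta10 t ^ 4 := by
  set x := Real.exp (-(Real.pi * t)) with hx
  set r := Real.exp (-(Real.pi * t) * (1 / 4)) with hr
  have hr0 : 0 < r := Real.exp_pos _
  have hrx : r ^ 4 = x := by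
    rw [hr, ← Real.exp_nat_mul, hx]
    congr 1
    push_cast
    ring
  have hrx' : r ^ 9 = r * x ^ 2 := by rw [← hrx]; ring
  have h := (summable_realTheta10 t ht).sum_le_tsum {0, -1, 1, -2}
    (fun n _ ↦ (Real.exp_pos _).le)
  have e0 : Real.exp (-(Real.pi * t) * (((0 : ℤ) : ℝ) + 1 / 2) ^ 2) = r := by
    rw [hr]; norm_num
  have e1 : Real.exp (-(Real.pi * t) * (((-1 : ℤ) : ℝ) + 1 / 2) ^ 2) = r := by
    rw [hr]; norm_num
  have e2 : Real.exp (-(Real.pi * t) * (((1 : ℤ) : ℝ) + 1 / 2) ^ 2) = r ^ 9 := by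
    rw [hr, ← Real.exp_nat_mul]; congr 1; push_cast; ring
  have e3 : Real.exp (-(Real.pi * t) * (((-2 : ℤ) : ℝ) + 1 / 2) ^ 2) = r ^ 9 := by
    rw [hr, ← Real.exp_nat_mul]; congr 1; push_cast; ring
  rw [Finset.sum_insert (by decide), Finset.sum_insert (by decide),
    Finset.sum_insert (by decide), Finset.sum_singleton, e0, e1, e2, e3, hrx'] at h
  have h' : 2 * r * (1 + x ^ 2) ≤ realTheta10 t := by
    rw [realTheta10]
    linarith
  calc 16 * x * (1 + 4 * x ^ 2) ≤ 16 * x * (1 + x ^ 2) ^ 4 := by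
        gcongr
        have := one_add_mul_le_pow (a := x ^ 2) (by nlinarith [sq_nonneg x]) 4
        push_cast at this
        exact this
    _ = (2 * r * (1 + x ^ 2)) ^ 4 := by rw [← hrx]; ring
    _ ≤ realTheta10 t ^ 4 := by gcongr

lemma realTheta01_ge (t : ℝ) (ht : 0 < t) :
    1 - 2 * Real.exp (-(Real.pi * t)) ≤ realTheta01 t := by
  set x := Real.exp (-(Real.pi * t)) with hx
  have hx0 : 0 < x := Real.exp_pos _
  have hx1 : x ≤ 1 := by
    rw [hx, Real.exp_le_one_iff]
    have := Real.pi_pos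
    have : 0 < Real.pi * t := by positivity
    linarith
  have h := (summable_realTheta01 t ht).hasSum.nat_add_neg.tendsto_sum_nat
  -- Pairing n with -n counts n = 0 twice, so the limit is Θ₀₁ + 1; the partial sum of the first two
  -- terms is 2 - 2x.
  have h' := Antitone.alternating_series_le_tendsto (f := fun n : ℕ ↦ 2 * x ^ (n ^ 2))
    (l := realTheta01 t + 1) ?_ ?_ 1
  · simp [Finset.sum_range_succ] at h'
    linarith
  · convert! h using 2 with n
    · refine Finset.sum_congr rfl fun i _ ↦ ?_
      have h1 : ((i : ℤ) ^ 2).toNat = i ^ 2 := by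
        rw [← Nat.cast_pow, Int.toNat_natCast]
      rw [neg_sq, h1, zpow_neg, zpow_natCast, ← inv_pow, inv_neg, inv_one]
      ring
    · simp [realTheta01]
  · intro m n hmn
    have : x ^ (n ^ 2) ≤ x ^ (m ^ 2) := pow_le_pow_of_le_one hx0.le hx1 (by gcongr)
    dsimp only
    linarith

/-- Jacobi's functional equation at (z/2, z); the fourth power removes the square root of t. -/
lemma realTheta01_inv_pow (t : ℝ) (ht : 0 < t) :
    realTheta01 t⁻¹ ^ 4 = t ^ 2 * realTheta10 t ^ 4 := by
  have ht' : (t : ℂ) ≠ 0 := by exact_mod_cast ht.ne'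
  have hz : ((imPoint t⁻¹ (inv_pos.2 ht) : ℍ) : ℂ) = -1 / (imPoint t ht : ℂ) := by
    simp only [imPoint]
    push_cast
    field_simp
    simp
  have h := jacobiTheta₂_functional_equation ((imPoint t ht : ℂ) / 2) (imPoint t ht)
  have hne : (imPoint t ht : ℂ) ≠ 0 := (imPoint t ht).ne_zero
  rw [← hz, div_div_cancel_left' hne, ← one_div, ← Theta01_eq_jacobiTheta₂,
    show -Complex.I * (imPoint t ht : ℂ) = t by
      simp only [imPoint]
      linear_combination (-t : ℂ) * Complex.I_mul_I] at h
  have h2 : Theta10 (imPoint t ht) = 1 / (t : ℂ) ^ (1 / 2 : ℂ) *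
      Theta01 (imPoint t⁻¹ (inv_pos.2 ht)) := by
    rw [Theta10_eq_jacobiTheta₂, h, ← mul_assoc, mul_left_comm, mul_assoc (1 / _), ← Complex.exp_add]
    rw [show (Real.pi : ℂ) * Complex.I * (imPoint t ht) / 4 +
      -Real.pi * Complex.I * ((imPoint t ht : ℂ) / 2) ^ 2 / (imPoint t ht) = 0 by
        field_simp
        ring]
    simp
  rw [Theta10_imPoint, Theta01_imPoint] at h2
  have h3 : ((t : ℂ) ^ (1 / 2 : ℂ)) ^ 4 = (t : ℂ) ^ 2 := by
    rw [← Complex.cpow_nat_mul]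
    norm_num
  apply Complex.ofReal_injective
  push_cast
  rw [h2, mul_pow, div_pow, h3]
  field_simp

lemma realTheta10_inv_pow (t : ℝ) (ht : 0 < t) :
    realTheta10 t⁻¹ ^ 4 = t ^ 2 * realTheta01 t ^ 4 := by
  have h := realTheta01_inv_pow t⁻¹ (inv_pos.2 ht)
  rw [inv_inv] at h
  rw [h]
  field_simp

end LeechPacking

/-! ### Assembly: the cases t ≥ 1 and t ≤ 1. -/

namespace LeechPacking

/-- The numerator of `φ` as a polynomial in `E₂`, `E₄`, `E₆`. -/
def phiNumerator (E₂ E₄ E₆ : ℝ) : ℝ :=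
  (25 * E₄ ^ 4 - 49 * E₆ ^ 2 * E₄) + 48 * E₆ * E₄ ^ 2 * E₂ + (-49 * E₄ ^ 3 + 25 * E₆ ^ 2) * E₂ ^ 2

/-- The numerator of `ψ_I` as a polynomial in `a = Θ₁₀⁴` and `b = Θ₀₁⁴`. -/
def psiNumerator (a b : ℝ) : ℝ := 7 * b ^ 5 * a ^ 2 + 7 * b ^ 6 * a + 2 * b ^ 7

/-- The real value `Δ(it)`. -/
noncomputable def realDelta (t : ℝ) : ℝ := (realE4 t ^ 3 - realE6 t ^ 2) / 1728

lemma phiNumerator_eq (E₂ E₄ E₆ : ℝ) : phiNumerator E₂ E₄ E₆ =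
    25 * (E₂ * E₆ - E₄ ^ 2) ^ 2 - 49 * E₄ * (E₂ * E₄ - E₆) ^ 2 := by
  rw [phiNumerator]
  ring

lemma Delta_imPoint (t : ℝ) (ht : 0 < t) : Delta (imPoint t ht) = (realDelta t : ℝ) := by
  rw [Delta, E4_imPoint, E6_imPoint, realDelta, realE4, realE6]
  push_cast
  rfl

lemma realDelta_ne_zero (t : ℝ) (ht : 0 < t) : realDelta t ≠ 0 := by
  have h : Delta (imPoint t ht) ≠ 0 := by
    rw [Delta, ← ModularForm.discriminant_eq_E₄_cube_sub_E₆_sq]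
    exact ModularForm.discriminant_ne_zero _
  rw [Delta_imPoint] at h
  exact_mod_cast h

lemma realDelta_inv (t : ℝ) (ht : 0 < t) : realDelta t⁻¹ = t ^ 12 * realDelta t := by
  rw [realDelta, realDelta, realE4_inv t ht, realE6_inv t ht]
  ring

lemma phi_imPoint (t : ℝ) (ht : 0 < t) : phi (imPoint t ht) =
    (phiNumerator (realE2 t) (realE4 t) (realE6 t) / realDelta t ^ 2 : ℝ) := by
  rw [phi, E4_imPoint, E6_imPoint, E2_imPoint, Delta_imPoint, phiNumerator, realE2, realE4, realE6]
  push_cast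
  rfl

lemma psiI_imPoint (t : ℝ) (ht : 0 < t) : psiI (imPoint t ht) =
    (psiNumerator (realTheta10 t ^ 4) (realTheta01 t ^ 4) / realDelta t ^ 2 : ℝ) := by
  rw [psiI, Theta01_imPoint, Theta10_imPoint, Delta_imPoint, psiNumerator]
  push_cast
  ring

lemma psiS_imPoint (t : ℝ) (ht : 0 < t) : psiS (imPoint t ht) =
    (-(t ^ 10 * (psiNumerator (realTheta10 t⁻¹ ^ 4) (realTheta01 t⁻¹ ^ 4) /
      realDelta t⁻¹ ^ 2)) : ℝ) := by
  rw [psiS, SlashInvariantForm.slash_S_apply, ← UpperHalfPlane.modular_S_smul, S_smul_imPoint,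
    psiI_imPoint, neg_neg]
  simp only [imPoint]
  rw [zpow_ofNat, mul_pow, show Complex.I ^ 10 = -1 by
    rw [show 10 = 2 * 5 by rfl, pow_mul, Complex.I_sq]; norm_num]
  push_cast
  ring

/-- The bound 0.0433 squares to less than 3/1600, the threshold for q. -/
lemma exp_neg_pi_mul_le {t : ℝ} (ht : 1 ≤ t) : Real.exp (-(Real.pi * t)) ≤ 433 / 10000 := by
  have h1 : Real.exp (-(Real.pi * t)) ≤ Real.exp (-3.14) := by
    gcongr
    nlinarith [Real.pi_gt_d2]
  have h2 : Real.exp (-3.14) ^ 50 ≤ (433 / 10000 : ℝ) ^ 50 := by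
    rw [← Real.exp_nat_mul, show ((50 : ℕ) : ℝ) * -3.14 = -((157 : ℕ) * 1) by norm_num,
      Real.exp_neg, Real.exp_nat_mul, inv_le_comm₀ (by positivity) (by positivity)]
    refine le_trans ?_ (pow_le_pow_left₀ (by norm_num) Real.exp_one_gt_d9.le 157)
    norm_num
  exact h1.trans ((pow_le_pow_iff_left₀ (Real.exp_nonneg _) (by norm_num) (by norm_num)).1 h2)

/-- The estimates for the building blocks of `φ` and `ψ` at `it` with `t ≥ 1`. -/
lemma estimates {t : ℝ} (ht : 1 ≤ t) {x : ℝ} (hx : x = Real.exp (-(Real.pi * t)))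
    {E₂ E₄ E₆ a b : ℝ} (h₂ : E₂ = realE2 t) (h₄ : E₄ = realE4 t) (h₆ : E₆ = realE6 t)
    (ha : a = realTheta10 t ^ 4) (hb : b = realTheta01 t ^ 4) :
    -(5040 ^ 2 * 163 * x ^ 6) ≤ phiNumerator E₂ E₄ E₆ ∧
    10080 * x ^ 2 * (12 + 1284 * x ^ 2 + 243600 * x ^ 4) ≤
      -(48 * E₆ * E₄ ^ 2 + 2 * (-49 * E₄ ^ 3 + 25 * E₆ ^ 2) * E₂) ∧
    -(67200 * x ^ 2 + 3100000 * x ^ 4) ≤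
      -49 * E₄ ^ 3 + 25 * E₆ ^ 2 + 12 * psiNumerator a b ∧
    7340032 * x ^ 5 ≤ psiNumerator b a := by
  have hx0 : 0 < x := hx ▸ Real.exp_pos _
  have hx1 : x ≤ 433 / 10000 := hx ▸ exp_neg_pi_mul_le ht
  obtain ⟨q, hq⟩ : ∃ q, q = Real.exp (-(2 * (Real.pi * t))) := ⟨_, rfl⟩
  have hqx : q = x ^ 2 := by
    rw [hq, hx, ← Real.exp_nat_mul]
    congr 1
    push_cast
    ring
  have hq0 : 0 < q := hq ▸ Real.exp_pos _
  have hq1 : q ≤ 3 / 1600 := by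
    rw [hqx]
    nlinarith
  have hE₆ : 0 ≤ E₆ := h₆ ▸ realE6_nonneg ht
  rw [realE2, ← hq] at h₂
  rw [realE4, ← hq] at h₄
  rw [realE6, ← hq] at h₆
  obtain ⟨⟨l₁, u₁⟩, ⟨l₃, u₃⟩, ⟨l₅, u₅⟩⟩ := sigmaSeries_bounds hq0 hq1
  have D₄u := serreDerivE4_le hq0 hq1 l₁ l₃ u₃ u₅
  have D₄l := le_serreDerivE4 hq0 hq1 l₁ u₁ l₃ u₃ l₅
  have D₆u := serreDerivE6_le hq0 hq1 l₁ u₁ l₃ l₅ u₅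
  have hN := numerator_ge hq0 hq1 l₃ u₃ D₄l D₄u D₆u
  have hC := neg_linearCoeff_ge hq0 hq1 l₃ u₅ (h₆ ▸ hE₆) D₄l D₆u
  have hB := quadraticCoeff_ge hq0 hq1 l₃ u₃ l₅ u₅
  rw [← h₂, ← h₄, ← h₆] at hN hC
  rw [← h₄, ← h₆] at hB
  have ha' : 16 * x * (1 + 4 * x ^ 2) ≤ a := by
    rw [ha, hx]
    exact realTheta10_pow_ge t (by linarith)
  have hb' : (1 - 2 * x) ^ 4 ≤ b := by
    rw [hb]
    have h := realTheta01_ge t (by linarith)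
    rw [← hx] at h
    have : 0 ≤ 1 - 2 * x := by linarith
    gcongr
  refine ⟨?_, ?_, ?_, ?_⟩
  · rw [phiNumerator_eq]
    rw [hqx] at hN
    linarith
  · rw [hqx] at hC
    linarith
  · have h := thetaNumerator_ge hx0 hx1 ha' hb'
    rw [psiNumerator]
    rw [hqx] at hB
    have hu := sub_nonneg.2 hx1
    nlinarith [mul_nonneg (pow_nonneg hx0.le 4) hu, mul_nonneg (pow_nonneg hx0.le 6) hu,
      mul_nonneg (pow_nonneg hx0.le 5) hu, pow_pos hx0 4, pow_pos hx0 6]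
  · have h := thetaNumerator_S_ge hx0 hx1 ha' hb'
    rw [psiNumerator]
    linarith

lemma phiNumerator_add_pos {t : ℝ} (ht : 1 ≤ t) :
    0 < phiNumerator (realE2 t) (realE4 t) (realE6 t) +
      432 / Real.pi ^ 2 * psiNumerator (realTheta01 t ^ 4) (realTheta10 t ^ 4) := by
  obtain ⟨hN, -, -, hT⟩ := estimates ht rfl rfl rfl rfl rfl rfl
  have hx1 := exp_neg_pi_mul_le ht
  have hx0 := Real.exp_pos (-(Real.pi * t))
  generalize Real.exp (-(Real.pi * t)) = x at *
  have hp : (43 : ℝ) ≤ 432 / Real.pi ^ 2 := by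
    rw [le_div_iff₀ (by positivity)]
    nlinarith [Real.pi_lt_d2, Real.pi_pos]
  have h : 43 * (7340032 * x ^ 5) ≤
      432 / Real.pi ^ 2 * psiNumerator (realTheta01 t ^ 4) (realTheta10 t ^ 4) := by gcongr
  nlinarith [mul_nonneg (pow_nonneg hx0.le 5) (sub_nonneg.2 hx1), pow_pos hx0 5]

lemma phiNumerator_inv_add_pos {s : ℝ} (hs : 1 ≤ s) :
    0 < Real.pi ^ 2 * s ^ 2 * phiNumerator (realE2 s) (realE4 s) (realE6 s) -
      6 * Real.pi * s * (48 * realE6 s * realE4 s ^ 2 +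
        2 * (-49 * realE4 s ^ 3 + 25 * realE6 s ^ 2) * realE2 s) +
      36 * (-49 * realE4 s ^ 3 + 25 * realE6 s ^ 2 +
        12 * psiNumerator (realTheta10 s ^ 4) (realTheta01 s ^ 4)) := by
  obtain ⟨hN, hC, hB, -⟩ := estimates hs rfl rfl rfl rfl rfl rfl
  have hy : Real.pi ≤ Real.pi * s := le_mul_of_one_le_right Real.pi_pos.le hs
  have h := leadingTerms_pos hy rfl
  rw [show Real.exp (-(2 * (Real.pi * s))) = Real.exp (-(Real.pi * s)) ^ 2 by
    rw [← Real.exp_nat_mul]; congr 1; push_cast; ring] at h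
  have hy0 : 0 < Real.pi * s := Real.pi_pos.trans_le hy
  have hx0 := Real.exp_pos (-(Real.pi * s))
  generalize Real.exp (-(Real.pi * s)) = x at *
  have h1 := mul_le_mul_of_nonneg_left hN (sq_nonneg (Real.pi * s))
  have h2 := mul_le_mul_of_nonneg_left hC hy0.le
  -- `leadingTerms_pos` has a factor q = x² divided out; it is restored here.
  have h3 := mul_pos (pow_pos hx0 2) h
  linarith

lemma real_pos (t : ℝ) (ht : 0 < t) :
    0 < phiNumerator (realE2 t) (realE4 t) (realE6 t) / realDelta t ^ 2 +
      432 / Real.pi ^ 2 * (t ^ 10 * (psiNumerator (realTheta10 t⁻¹ ^ 4) (realTheta01 t⁻¹ ^ 4) /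
        realDelta t⁻¹ ^ 2)) := by
  rcases le_total 1 t with h | h
  · have hD := realDelta_ne_zero t ht
    have key := phiNumerator_add_pos h
    rw [realDelta_inv t ht, realTheta10_inv_pow t ht, realTheta01_inv_pow t ht]
    have : phiNumerator (realE2 t) (realE4 t) (realE6 t) / realDelta t ^ 2 +
      432 / Real.pi ^ 2 * (t ^ 10 * (psiNumerator (t ^ 2 * realTheta01 t ^ 4)
        (t ^ 2 * realTheta10 t ^ 4) / (t ^ 12 * realDelta t) ^ 2)) =
      (phiNumerator (realE2 t) (realE4 t) (realE6 t) +
        432 / Real.pi ^ 2 * psiNumerator (realTheta01 t ^ 4) (realTheta10 t ^ 4)) /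
        realDelta t ^ 2 := by
      rw [psiNumerator, psiNumerator]
      field_simp
    rw [this]
    positivity
  · obtain ⟨s, hs, rfl⟩ : ∃ s : ℝ, 1 ≤ s ∧ t = s⁻¹ :=
      ⟨t⁻¹, (one_le_inv₀ ht).2 h, (inv_inv t).symm⟩
    have hs0 : 0 < s := by linarith
    have hD := realDelta_ne_zero s hs0
    have hp := Real.pi_pos
    have key := phiNumerator_inv_add_pos hs
    rw [inv_inv, realDelta_inv s hs0, realE2_inv s hs0, realE4_inv s hs0, realE6_inv s hs0]
    have : phiNumerator (-s ^ 2 * realE2 s + 6 * s / Real.pi) (s ^ 4 * realE4 s)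
        (-s ^ 6 * realE6 s) / (s ^ 12 * realDelta s) ^ 2 +
      432 / Real.pi ^ 2 * (s⁻¹ ^ 10 * (psiNumerator (realTheta10 s ^ 4) (realTheta01 s ^ 4) /
        realDelta s ^ 2)) = (Real.pi ^ 2 * s ^ 2 * phiNumerator (realE2 s) (realE4 s) (realE6 s) -
      6 * Real.pi * s * (48 * realE6 s * realE4 s ^ 2 +
        2 * (-49 * realE4 s ^ 3 + 25 * realE6 s ^ 2) * realE2 s) +
      36 * (-49 * realE4 s ^ 3 + 25 * realE6 s ^ 2 +
        12 * psiNumerator (realTheta10 s ^ 4) (realTheta01 s ^ 4))) /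
        (Real.pi ^ 2 * s ^ 10 * realDelta s ^ 2) := by
      generalize psiNumerator (realTheta10 s ^ 4) (realTheta01 s ^ 4) = P
      rw [phiNumerator, phiNumerator]
      field_simp
      ring
    rw [this]
    positivity

end LeechPacking

/-- For all `t > 0`, the number `φ(it) - (432 / π²) ψ_S(it)` is real and positive. -/
theorem lemmaA2 (t : ℝ) (ht : 0 < t) :
    (LeechPacking.phi (LeechPacking.imPoint t ht)
        - 432 / (Real.pi : ℂ) ^ 2 * LeechPacking.psiS (LeechPacking.imPoint t ht)).im = 0 ∧
    0 < (LeechPacking.phi (LeechPacking.imPoint t ht)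
        - 432 / (Real.pi : ℂ) ^ 2 * LeechPacking.psiS (LeechPacking.imPoint t ht)).re := by
  open LeechPacking in
  have h : phi (imPoint t ht) - 432 / (Real.pi : ℂ) ^ 2 * psiS (imPoint t ht) =
      (phiNumerator (realE2 t) (realE4 t) (realE6 t) / realDelta t ^ 2 +
      432 / Real.pi ^ 2 * (t ^ 10 * (psiNumerator (realTheta10 t⁻¹ ^ 4) (realTheta01 t⁻¹ ^ 4) /
        realDelta t⁻¹ ^ 2)) : ℝ) := by
    rw [phi_imPoint, psiS_imPoint]
    push_cast
    ring
  rw [h]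
  exact ⟨Complex.ofReal_im _, (Complex.ofReal_re _).symm ▸ LeechPacking.real_pos t ht⟩
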